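/- A *rooted tree* $T$ is here the tree $T_{\mathfrak X}$ of all finite strings $x_1\dots x_n$ ($n\ge 0$, $x_i\in X_i$) over a sequence $\mathfrak X=(X_n)_{n\ge 1}$ of finite sets with $|X_n|\ge 2$; the $n$-th layer is the set of strings of length $n$, and $\operatorname{Aut}(T)$ is the group of graph automorphisms of $T$ that fix the root. For $g\in\operatorname{Aut}(T)$ and a vertex $v$, the section $g|_v$ is the automorphism of the subtree at $v$ (the tree over $X_{|v|+1},X_{|v|+2},\dots$) such that $vw$ is mapped by $g$ to the string consisting of the image of $v$ under $g$ followed by the image of $w$ under $g|_v$; the label of $g$ at $v$ is the permutation of $X_{|v|+1}$ induced by $g|_v$. For $\Gamma\le\operatorname{Aut}(T)$, $\operatorname{rist}_\Gamma(v)$ is the group of those $g\in\Gamma$ that fix the layer of $v$ pointwise and satisfy $g|_u=\mathrm{id}$ for every $u\ne v$ in that layer. The group $\Gamma$ is a *branch group* if it acts transitively on every layer and, for every $n$, the subgroup $\langle \operatorname{rist}_\Gamma(v) : |v|=n\rangle$ has finite index in $\Gamma$; it is *layered* if $\{g|_v : g\in\operatorname{rist}_\Gamma(v)\}=\{g|_v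 : g\in\Gamma\}$ for every vertex $v$. For a sequence $\mathfrak S=(S_n)_{n\ge 0}$ of subgroups $S_n\le\operatorname{Sym}(X_{n+1})$, let $\operatorname{Aut}_{\mathfrak S}(T)$ be the group of all $g\in\operatorname{Aut}(T)$ whose label at each vertex $v$ lies in $S_{|v|}$, and let $\operatorname{Fin}_{\mathfrak S}(T)$ be its subgroup of finitary elements, i.e. of those $g$ for which there is $n$ with $g|_v=\mathrm{id}$ for all $v$ of length $n$. A group $G$ is *countably based residually-(finite perfect)* if there are a countable family $(P_i)_{i\in I}$ of finite perfect groups and an injective homomorphism $G\to\prod_{i\in I}P_i$ whose composition with each projection to $P_i$ is surjective. **Theorem.** Let $G$ be a countably based residually-(finite perfect) group. Then there are a rooted tree $T$ as above, a sequence $\mathfrak S$ of subgroups $S_n\le\operatorname{Sym}(X_{n+1})$, a layered branch group $\Gamma\le\operatorname{Aut}(T)$ with $\operatorname{Fin}_{\mathfrak S}(T)\le\Gamma\le\operatorname{Aut}_{\mathfrak S}(T)$, and an injective homomorphism $\iota\colon G\to\Gamma$ such that $$M\longmapsto \langle \operatorname{Fin}_{\mathfrak S}(T)\cup\iota(M)\rangle$$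 is an injective map from the set of maximal subgroups of $G$ that are not normal in $G$ into the set of maximal subgroups of $\Gamma$, and such that $\Gamma$ is finitely generated if $G$ is. -/

import Mathlib

universe u

/-! ### Countably based residually-(finite perfect) groups -/

/-- `G` admits a faithful representation `φ : G → ∏ i, S i` onto a subdirect product of a countable
family of finite perfect groups. (A finite group lives in `Type` up to isomorphism, and so does a
countable index set.) -/
def IsCountablyBasedResiduallyFinitePerfect (G : Type u) [Group G] : Prop :=
  ∃ (I : Type) (S : I → Type) (_ : ∀ i, Group (S i)) (φ : G →* (∀ i, S i)),
    Countable I ∧ (∀ i, Finite (S i)) ∧ (∀ i, Group.IsPerfect (S i)) ∧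
    Function.Injective φ ∧ ∀ i, Function.Surjective fun g : G => φ g i

/-! ### Spherically homogeneous rooted trees -/

namespace RootedTree

/-- `Vertex X m` is the set of vertices of the rooted tree of all finite strings
`x₀ x₁ … xₖ₋₁` with `xᵢ ∈ X (m + i)`, that is, of the rooted tree defined by the sequence
`X m, X (m + 1), …`. The tree `T` defined by `X` is the case `m = 0`; its `m`-th shift is
`Vertex X m`. -/
inductive Vertex (X : ℕ → Type) : ℕ → Type
  | root (m : ℕ) : Vertex X m
  | cons {m : ℕ} (x : X m) (v : Vertex X (m + 1)) : Vertex X m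

namespace Vertex

variable {X : ℕ → Type}

/-- The length of a string, that is, its distance to the root. -/
def length : {m : ℕ} → Vertex X m → ℕ
  | _, root _ => 0
  | _, cons _ v => v.length + 1

/-- The index at which the letters of a continuation of the string `v` start. -/
def endLevel : {m : ℕ} → Vertex X m → ℕ
  | m, root _ => m
  | _, cons _ v => v.endLevel

theorem endLevel_eq : {m : ℕ} → (v : Vertex X m) → v.endLevel = m + v.length
  | _, root _ => rfl
  | m, cons _ v => by
    have := endLevel_eq v
    simp only [endLevel, length]
    omega

/-- The string without its first letter (the root is sent to the root). -/
def tail : {m : ℕ} → Vertex X m → Vertex X (m + 1)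
  | m, root _ => root (m + 1)
  | _, cons _ v => v

/-- `IsChild v w` means that `w` arises from `v` by appending one letter. -/
inductive IsChild : {m : ℕ} → Vertex X m → Vertex X m → Prop
  | root {m : ℕ} (x : X m) : IsChild (Vertex.root m) (Vertex.cons x (Vertex.root (m + 1)))
  | cons {m : ℕ} (x : X m) {v w : Vertex X (m + 1)} (h : IsChild v w) :
      IsChild (Vertex.cons x v) (Vertex.cons x w)

theorem IsChild.length_eq {m : ℕ} {v w : Vertex X m} (h : IsChild v w) :
    w.length = v.length + 1 := by
  induction h with
  | root x => rfl
  | cons x h ih => simp [length, ih]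

theorem not_isChild_root {m : ℕ} {v : Vertex X m} : ¬ IsChild v (root m) := by
  intro h
  have := h.length_eq
  simp [length] at this

theorem IsChild.parent_unique {m : ℕ} {v v' w : Vertex X m} (h : IsChild v w)
    (h' : IsChild v' w) : v = v' := by
  induction h with
  | root x =>
    cases h' with
    | root _ => rfl
    | cons _ h' => exact (not_isChild_root h').elim
  | cons x h ih =>
    cases h' with
    | root _ => exact (not_isChild_root h).elim
    | cons _ h' => rw [ih h']

theorem isChild_cons_iff {m : ℕ} {x : X m} {v w : Vertex X (m + 1)} :
    IsChild (cons x v) (cons x w) ↔ IsChild v w := by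
  refine ⟨fun h => ?_, IsChild.cons x⟩
  cases h with
  | cons _ h => exact h

theorem exists_parent : {m : ℕ} → (w : Vertex X m) → w = root m ∨ ∃ v, IsChild v w
  | _, root _ => Or.inl rfl
  | _, cons x w => by
    right
    rcases exists_parent w with rfl | ⟨v, hv⟩
    · exact ⟨_, IsChild.root x⟩
    · exact ⟨_, IsChild.cons x hv⟩

theorem child_induction {m : ℕ} {P : Vertex X m → Prop} (h0 : P (root m))
    (h1 : ∀ v w, IsChild v w → P v → P w) (w : Vertex X m) : P w := by
  generalize hn : w.length = n
  induction n generalizing w with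
  | zero =>
    rcases exists_parent w with rfl | ⟨v, hv⟩
    · exact h0
    · have := hv.length_eq
      omega
  | succ n ih =>
    rcases exists_parent w with rfl | ⟨v, hv⟩
    · exact h0
    · have := hv.length_eq
      exact h1 v w hv (ih v (by omega))

end Vertex

open Vertex

/-- The tree as a graph: `v` and `w` are adjacent if one arises from the other by appending one
letter. -/
def treeGraph (X : ℕ → Type) (m : ℕ) : SimpleGraph (Vertex X m) where
  Adj v w := IsChild v w ∨ IsChild w v
  symm := ⟨fun _ _ h => h.symm⟩
  loopless := ⟨fun v h => by
    have : v.length = v.length + 1 := by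
      rcases h with h | h <;> exact h.length_eq
    omega⟩

/-- The automorphism group of the rooted tree: graph automorphisms that fix the root. -/
def treeAut (X : ℕ → Type) (m : ℕ) : Subgroup (Equiv.Perm (Vertex X m)) where
  carrier := {g | g (root m) = root m ∧
    ∀ v w, (treeGraph X m).Adj (g v) (g w) ↔ (treeGraph X m).Adj v w}
  one_mem' := ⟨rfl, fun _ _ => Iff.rfl⟩
  mul_mem' {g h} hg hh := by
    refine ⟨?_, fun v w => ?_⟩
    · rw [Equiv.Perm.mul_apply, hh.1, hg.1]
    · rw [Equiv.Perm.mul_apply, Equiv.Perm.mul_apply, hg.2, hh.2]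
  inv_mem' {g} hg := by
    refine ⟨?_, fun v w => ?_⟩
    · rw [Equiv.Perm.inv_eq_iff_eq, hg.1]
    · have h := hg.2 (g⁻¹ v) (g⁻¹ w)
      simp only [Equiv.Perm.inv_def, Equiv.apply_symm_apply] at h ⊢
      exact h.symm

/-- `TreeAut X m` is the automorphism group of the `m`-th shift of the tree defined by `X`; in
particular `TreeAut X 0` is `Aut(T)`. -/
abbrev TreeAut (X : ℕ → Type) (m : ℕ) : Type := treeAut X m

namespace TreeAut

variable {X : ℕ → Type} {m : ℕ}

theorem isChild_map (g : TreeAut X m) {v w : Vertex X m} (h : IsChild v w) :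
    IsChild (g.1 v) (g.1 w) := by
  revert w
  refine child_induction (P := fun v => ∀ {w}, IsChild v w → IsChild (g.1 v) (g.1 w)) ?_ ?_ v
  · intro w h
    rcases (g.2.2 _ _).2 (Or.inl h) with h' | h'
    · exact h'
    · rw [g.2.1] at h'
      exact (not_isChild_root h').elim
  · intro p v hpv ih w hvw
    rcases (g.2.2 _ _).2 (Or.inl hvw) with h' | h'
    · exact h'
    · have := g.1.injective (h'.parent_unique (ih hpv))
      subst this
      have h1 := hpv.length_eq
      have h2 := hvw.length_eq
      omega

/-- The image of the one-letter string `x` under `g`, as a letter. -/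
def letter (g : TreeAut X m) (x : X m) : X m :=
  match g.1 (cons x (root (m + 1))) with
  | root _ => x
  | cons y _ => y

theorem apply_letter (g : TreeAut X m) (x : X m) :
    g.1 (cons x (root (m + 1))) = cons (g.letter x) (root (m + 1)) := by
  have h := g.isChild_map (IsChild.root x)
  rw [g.2.1] at h
  unfold letter
  generalize g.1 (cons x (root (m + 1))) = v at h
  cases h with
  | root y => rfl

theorem apply_cons (g : TreeAut X m) (x : X m) (w : Vertex X (m + 1)) :
    g.1 (cons x w) = cons (g.letter x) (g.1 (cons x w)).tail := by
  refine child_induction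
    (P := fun w => g.1 (cons x w) = cons (g.letter x) (g.1 (cons x w)).tail) ?_ ?_ w
  · rw [apply_letter]
    rfl
  · intro v w hvw ih
    have h := g.isChild_map (IsChild.cons x hvw)
    rw [ih] at h
    generalize g.1 (cons x w) = z at h
    cases h with
    | cons _ h => rfl

theorem letter_inv_letter (g : TreeAut X m) (x : X m) : g⁻¹.letter (g.letter x) = x := by
  have h := apply_letter g⁻¹ (g.letter x)
  rw [← apply_letter g x] at h
  have h' : (g⁻¹).1 (g.1 (cons x (root (m + 1)))) = cons x (root (m + 1)) :=
    Equiv.symm_apply_apply g.1 _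
  rw [h'] at h
  injection h with _ h
  exact h.symm

/-- The permutation of the first layer induced by `g`: its label at the root. -/
def rootLabel (g : TreeAut X m) : Equiv.Perm (X m) where
  toFun := g.letter
  invFun := g⁻¹.letter
  left_inv := g.letter_inv_letter
  right_inv x := by
    have := g⁻¹.letter_inv_letter x
    rwa [inv_inv] at this

/-- The section `g|ₓ` at a letter `x`: the automorphism with `g (x w) = (g x) (g|ₓ w)`. -/
def letterSection (g : TreeAut X m) (x : X m) : TreeAut X (m + 1) :=
  ⟨{ toFun := fun w => (g.1 (cons x w)).tail
     invFun := fun w => ((g⁻¹).1 (cons (g.letter x) w)).tail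
     left_inv := fun w => by
       have h : (g⁻¹).1 (g.1 (cons x w)) = cons x w := Equiv.symm_apply_apply g.1 _
       change ((g⁻¹).1 (cons (g.letter x) (g.1 (cons x w)).tail)).tail = w
       rw [← apply_cons, h]
       rfl
     right_inv := fun w => by
       have h := apply_cons g⁻¹ (g.letter x) w
       rw [letter_inv_letter] at h
       change (g.1 (cons x ((g⁻¹).1 (cons (g.letter x) w)).tail)).tail = w
       rw [← h]
       have h' : g.1 ((g⁻¹).1 (cons (g.letter x) w)) = cons (g.letter x) w :=
         Equiv.apply_symm_apply g.1 _
       rw [h']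
       rfl },
   by
    refine ⟨?_, fun v w => ?_⟩
    · change (g.1 (cons x (root (m + 1)))).tail = root (m + 1)
      rw [apply_letter]
      rfl
    · have h := g.2.2 (cons x v) (cons x w)
      rw [apply_cons g x v, apply_cons g x w] at h
      simp only [treeGraph, isChild_cons_iff] at h
      exact h⟩

theorem apply_cons_eq (g : TreeAut X m) (x : X m) (w : Vertex X (m + 1)) :
    g.1 (cons x w) = cons (g.rootLabel x) ((g.letterSection x).1 w) :=
  apply_cons g x w

/-- The section `g|ᵥ = g|ₓ₁|ₓ₂…|ₓₙ` at the vertex `v = x₁ x₂ … xₙ`. -/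
def sectionAt : {m : ℕ} → TreeAut X m → (v : Vertex X m) → TreeAut X v.endLevel
  | _, g, root _ => g
  | _, g, cons x v => sectionAt (g.letterSection x) v

/-- The label of `g` at the vertex `v`: the permutation by which the section `g|ᵥ` acts on the
letters that continue `v`. -/
def label (g : TreeAut X m) (v : Vertex X m) : Equiv.Perm (X v.endLevel) :=
  (g.sectionAt v).rootLabel

/-- `g` is finitary: for some `n`, all its sections at vertices of length `n` are trivial. -/
def IsFinitary (g : TreeAut X m) : Prop :=
  ∃ n : ℕ, ∀ v : Vertex X m, v.length = n → g.sectionAt v = 1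

end TreeAut

variable {X : ℕ → Type}

/-- `Aut_S(T)`: the automorphisms all of whose labels lie in the sequence `S`. -/
def autLabels (S : ∀ n, Subgroup (Equiv.Perm (X n))) : Set (TreeAut X 0) :=
  {g | ∀ v : Vertex X 0, g.label v ∈ S v.endLevel}

/-- `Fin_S(T)`: the finitary automorphisms all of whose labels lie in the sequence `S`. -/
def finLabels (S : ∀ n, Subgroup (Equiv.Perm (X n))) : Set (TreeAut X 0) :=
  {g | g.IsFinitary ∧ g ∈ autLabels S}

/-! ### Branch groups and layered groups -/

/-- `Γ` acts transitively on every layer of the tree. -/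
def IsSphericallyTransitive (Γ : Subgroup (TreeAut X 0)) : Prop :=
  ∀ v w : Vertex X 0, v.length = w.length → ∃ g ∈ Γ, g.1 v = w

/-- The rigid vertex stabiliser `rist_Γ(v)`: the elements of `Γ` that fix the layer of `v`
pointwise and have trivial section at each vertex of that layer other than `v`. -/
def rist (Γ : Subgroup (TreeAut X 0)) (v : Vertex X 0) : Set (TreeAut X 0) :=
  {g | g ∈ Γ ∧ (∀ u : Vertex X 0, u.length = v.length → g.1 u = u) ∧
    ∀ u : Vertex X 0, u.length = v.length → u ≠ v → g.sectionAt u = 1}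

/-- The rigid layer stabiliser `Rist_Γ(n)`, generated by the rigid stabilisers of the vertices of
length `n`. -/
def ristLayer (Γ : Subgroup (TreeAut X 0)) (n : ℕ) : Subgroup (TreeAut X 0) :=
  Subgroup.closure (⋃ v ∈ {v : Vertex X 0 | v.length = n}, rist Γ v)

/-- `Γ` is a branch group. -/
def IsBranch (Γ : Subgroup (TreeAut X 0)) : Prop :=
  IsSphericallyTransitive Γ ∧ ∀ n : ℕ, ((ristLayer Γ n).subgroupOf Γ).FiniteIndex

/-- `Γ` is layered: `rist_Γ(v) = Γ|ᵥ` for all `v`, where `rist_Γ(v)` is regarded as a group of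
automorphisms of the subtree at `v` by taking sections at `v`, and `Γ|ᵥ` is the set of the sections
at `v` of all elements of `Γ`. -/
def IsLayered (Γ : Subgroup (TreeAut X 0)) : Prop :=
  ∀ v : Vertex X 0, (fun g : TreeAut X 0 => g.sectionAt v) '' rist Γ v =
    (fun g : TreeAut X 0 => g.sectionAt v) '' (Γ : Set (TreeAut X 0))

/-- The subgroup `⟨Fin_S(T) ∪ H⟩` of `Γ`, for a subgroup `H` of a group `G` that is mapped to `Γ`
by `ι`. -/
def adjoinFin {G : Type u} [Group G] (S : ∀ n, Subgroup (Equiv.Perm (X n)))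
    (Γ : Subgroup (TreeAut X 0)) (ι : G →* Γ) (H : Subgroup G) : Subgroup Γ :=
  Subgroup.closure ({γ : Γ | (γ : TreeAut X 0) ∈ finLabels S} ∪ ι '' (H : Set G))

end RootedTree

/-- The set of non-normal maximal subgroups of `G`. -/
def nonNormalMaximal (G : Type u) [Group G] : Set (Subgroup G) :=
  {M | IsCoatom M ∧ ¬ M.Normal}

/-! The group `G` acts by directed automorphisms: `spine g` fixes the first layer, its section at
the letter of a fixed ray is `spine g` one level down, and its other sections are rooted
permutations given by images of `g` in the label groups. For `M ≤ G`, the group `tame M` consists of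
the automorphisms with labels in the label groups whose sections, from some level on, are all of the
form `spine g` with `g ∈ M`. Then `tame ⊥` is Fin, `tame M` is generated by Fin and the spines of
`M` (`tame_eq_sup`), and Γ is `tame ⊤`. It is layered and branch because any of its sections can be
put back on a single subtree. The subgroup `M` can be read off from `tame M`, since spines are
faithful on every level.

Maximality (`tame_top_le_of_mem`): if `H` contains `tame M` and some `γ` of Γ outside it, then, by
induction on `γ`, the layer stabiliser in `H` projects onto all of `tame ⊤` at some letter.
Non-normality supplies `k ∈ M` and `g` with `[g, k] ∉ M`. A commutator with a copy of `spine k`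
supported at that letter isolates `spine [g, k]` there, and maximality of `M` does the rest.

Finite generation (`tame_translationSystem_le`): the letters of level `m` form a finite perfect
quotient `P m` of `G`, and the labels are its two-sided translations. A spine has at most three
nontrivial sections. Point stabilisers act by conjugation and move the unwanted ones apart, so
commutators separate the sections, and perfectness recovers every value from commutators. Hence the
rooted translations of level 0 and the spines generate Γ. Each quotient is used infinitely often,
which keeps spines faithful. -/

namespace RootedTree

open Vertex

variable {X : ℕ → Type} {m : ℕ}

/-! ### Strings and finite layers -/

namespace Vertex

theorem isChild_root_cons_iff {x : X m} {v : Vertex X (m + 1)} :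
    IsChild (root m) (cons x v) ↔ v = root (m + 1) := by
  constructor
  · intro h
    cases h
    rfl
  · rintro rfl
    exact IsChild.root x

theorem isChild_cons_cons_iff {x y : X m} {v w : Vertex X (m + 1)} :
    IsChild (cons x v) (cons y w) ↔ x = y ∧ IsChild v w := by
  constructor
  · intro h
    cases h with
    | cons _ h => exact ⟨rfl, h⟩
  · rintro ⟨rfl, h⟩
    exact IsChild.cons x h

theorem finite_length_eq [∀ m, Finite (X m)] (n : ℕ) :
    ∀ m, Finite {v : Vertex X m // v.length = n} := by
  induction n with
  | zero =>
    intro m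
    have : Subsingleton {v : Vertex X m // v.length = 0} := by
      refine ⟨?_⟩
      rintro ⟨_ | _, h⟩ ⟨_ | _, h'⟩
      · rfl
      · simp [length] at h'
      · simp [length] at h
      · simp [length] at h
    infer_instance
  | succ n ih =>
    intro m
    have := ih (m + 1)
    let e : X m × {v : Vertex X (m + 1) // v.length = n} →
        {v : Vertex X m // v.length = n + 1} :=
      fun p => ⟨cons p.1 p.2.1, by simp [length, p.2.2]⟩
    refine Finite.of_surjective e ?_
    rintro ⟨_ | ⟨x, v⟩, h⟩
    · simp [length] at h
    · exact ⟨(x, ⟨v, by simpa [length] using h⟩), rfl⟩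

end Vertex

/-! ### Wreath recursion: labels, sections and automorphisms supported on a subtree -/

namespace TreeAut

theorem apply_root (g : TreeAut X m) : g.1 (root m) = root m := g.2.1

theorem length_apply : ∀ {m : ℕ} (v : Vertex X m) (g : TreeAut X m),
    (g.1 v).length = v.length
  | _, root _, g => by rw [apply_root]
  | _, cons x v, g => by
    rw [apply_cons_eq]
    simp only [length, length_apply v]

theorem ext_sections {g h : TreeAut X m} (h1 : g.rootLabel = h.rootLabel)
    (h2 : ∀ x, g.letterSection x = h.letterSection x) : g = h := by
  refine Subtype.ext (Equiv.ext fun v => ?_)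
  cases v with
  | root => rw [apply_root, apply_root]
  | cons x v => rw [apply_cons_eq, apply_cons_eq, h1, h2]

/-- Injectivity of `cons` makes the recursion formula determine label and sections; those of
products, spines and `ofSections` are all computed this way. -/
theorem rootLabel_eq_and_letterSection_eq {g : TreeAut X m} {σ : Equiv.Perm (X m)}
    {f : X m → TreeAut X (m + 1)}
    (h : ∀ x v, g.1 (cons x v) = cons (σ x) ((f x).1 v)) :
    g.rootLabel = σ ∧ ∀ x, g.letterSection x = f x := by
  have key : ∀ x v, g.rootLabel x = σ x ∧ (g.letterSection x).1 v = (f x).1 v := by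
    intro x v
    have := h x v
    rw [apply_cons_eq] at this
    injection this with _ h1 h2
    exact ⟨h1, h2⟩
  exact ⟨Equiv.ext fun x => (key x (root _)).1,
    fun x => Subtype.ext (Equiv.ext fun v => (key x v).2)⟩

theorem rootLabel_mul (g h : TreeAut X m) :
    (g * h).rootLabel = g.rootLabel * h.rootLabel :=
  (rootLabel_eq_and_letterSection_eq (g := g * h)
    (f := fun x => g.letterSection (h.rootLabel x) * h.letterSection x) fun x v => by
      change g.1 (h.1 (cons x v)) = _
      rw [apply_cons_eq, apply_cons_eq]
      rfl).1

theorem letterSection_mul (g h : TreeAut X m) (x : X m) :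
    (g * h).letterSection x = g.letterSection (h.rootLabel x) * h.letterSection x :=
  (rootLabel_eq_and_letterSection_eq (g := g * h) (σ := g.rootLabel * h.rootLabel)
    (f := fun x => g.letterSection (h.rootLabel x) * h.letterSection x) (fun x v => by
      change g.1 (h.1 (cons x v)) = _
      rw [apply_cons_eq, apply_cons_eq]
      rfl)).2 x

theorem rootLabel_one : (1 : TreeAut X m).rootLabel = 1 :=
  (rootLabel_eq_and_letterSection_eq (g := 1) (f := 1) fun _ _ => rfl).1

theorem letterSection_one (x : X m) : (1 : TreeAut X m).letterSection x = 1 :=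
  (rootLabel_eq_and_letterSection_eq (g := 1) (σ := 1) (f := 1) fun _ _ => rfl).2 x

theorem rootLabel_inv (g : TreeAut X m) : g⁻¹.rootLabel = g.rootLabel⁻¹ := by
  rw [eq_inv_iff_mul_eq_one, ← rootLabel_mul, inv_mul_cancel, rootLabel_one]

theorem letterSection_inv (g : TreeAut X m) (x : X m) :
    g⁻¹.letterSection x = (g.letterSection (g.rootLabel⁻¹ x))⁻¹ := by
  rw [eq_inv_iff_mul_eq_one]
  have := letterSection_mul g⁻¹ g (g.rootLabel⁻¹ x)
  have hx : g.rootLabel (g.rootLabel⁻¹ x) = x := Equiv.apply_symm_apply _ _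
  rw [inv_mul_cancel, letterSection_one, hx] at this
  exact this.symm

/-- The automorphism with root label `σ` and sections `f x` at the letters `x`. -/
def ofSections (σ : Equiv.Perm (X m)) (f : X m → TreeAut X (m + 1)) : TreeAut X m :=
  ⟨{ toFun := fun v => match v with
       | root _ => root m
       | cons x v => cons (σ x) ((f x).1 v)
     invFun := fun v => match v with
       | root _ => root m
       | cons x v => cons (σ.symm x) ((f (σ.symm x)).1.symm v)
     left_inv := fun v => by cases v <;> simp
     right_inv := fun v => by cases v <;> simp },
   by
    refine ⟨rfl, fun v w => ?_⟩
    have hr : ∀ (x : X m) (u : Vertex X (m + 1)),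
        (f x).1 u = root (m + 1) ↔ u = root (m + 1) := fun x u => by
      conv_lhs => rw [← (f x).2.1]
      exact (f x).1.injective.eq_iff
    cases v with
    | root =>
      cases w with
      | root => simp [treeGraph]
      | cons x w => simp [treeGraph, not_isChild_root, isChild_root_cons_iff, hr]
    | cons x v =>
      cases w with
      | root => simp [treeGraph, not_isChild_root, isChild_root_cons_iff, hr]
      | cons y w =>
        simp only [treeGraph, Equiv.coe_fn_mk, isChild_cons_cons_iff, σ.injective.eq_iff]
        have key := (f x).2.2 v w
        simp only [treeGraph] at key
        by_cases hxy : x = y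
        · subst hxy
          simpa using key
        · simp [hxy, Ne.symm hxy]⟩

@[simp]
theorem rootLabel_ofSections (σ : Equiv.Perm (X m)) (f : X m → TreeAut X (m + 1)) :
    (ofSections σ f).rootLabel = σ :=
  (rootLabel_eq_and_letterSection_eq (f := f) fun _ _ => rfl).1

@[simp]
theorem letterSection_ofSections (σ : Equiv.Perm (X m)) (f : X m → TreeAut X (m + 1))
    (x : X m) : (ofSections σ f).letterSection x = f x :=
  (rootLabel_eq_and_letterSection_eq (σ := σ) fun _ _ => rfl).2 x

/-- The automorphisms that fix the first layer, given by their sections. -/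
def layerHom (X : ℕ → Type) (m : ℕ) : (X m → TreeAut X (m + 1)) →* TreeAut X m where
  toFun f := ofSections 1 f
  map_one' := ext_sections (by simp [rootLabel_one]) fun x => by simp [letterSection_one]
  map_mul' f g := ext_sections (by simp [rootLabel_mul]) fun x => by simp [letterSection_mul]

/-- The rooted automorphisms. -/
def rooted (X : ℕ → Type) (m : ℕ) : Equiv.Perm (X m) →* TreeAut X m where
  toFun σ := ofSections σ 1
  map_one' := ext_sections (by simp [rootLabel_one]) fun x => by simp [letterSection_one]
  map_mul' f g := ext_sections (by simp [rootLabel_mul]) fun x => by simp [letterSection_mul]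

@[simp]
theorem rootLabel_layerHom (f : X m → TreeAut X (m + 1)) : (layerHom X m f).rootLabel = 1 :=
  rootLabel_ofSections _ _

@[simp]
theorem letterSection_layerHom (f : X m → TreeAut X (m + 1)) (x : X m) :
    (layerHom X m f).letterSection x = f x :=
  letterSection_ofSections _ _ _

@[simp]
theorem rootLabel_rooted (σ : Equiv.Perm (X m)) : (rooted X m σ).rootLabel = σ :=
  rootLabel_ofSections _ _

@[simp]
theorem letterSection_rooted (σ : Equiv.Perm (X m)) (x : X m) :
    (rooted X m σ).letterSection x = 1 :=
  letterSection_ofSections _ _ _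

/-- The wreath product decomposition. -/
theorem rooted_mul_layerHom (g : TreeAut X m) :
    rooted X m g.rootLabel * layerHom X m g.letterSection = g :=
  ext_sections (by simp [rootLabel_mul]) fun x => by simp [letterSection_mul]

theorem layerHom_letterSection {g : TreeAut X m} (h : g.rootLabel = 1) :
    layerHom X m g.letterSection = g := by
  simpa [h] using rooted_mul_layerHom g

theorem rooted_conj_layerHom (σ : Equiv.Perm (X m)) (f : X m → TreeAut X (m + 1)) :
    rooted X m σ * layerHom X m f * (rooted X m σ)⁻¹ = layerHom X m (f ∘ ⇑σ⁻¹) := by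
  rw [mul_inv_eq_iff_eq_mul]
  exact ext_sections (by simp [rootLabel_mul]) fun x => by simp [letterSection_mul]

open Classical in
/-- The automorphisms supported on the subtree at the letter `x`. -/
noncomputable def single (x : X m) : TreeAut X (m + 1) →* TreeAut X m :=
  (layerHom X m).comp (MonoidHom.mulSingle (fun _ => TreeAut X (m + 1)) x)

open Classical in
theorem single_apply (x : X m) (g : TreeAut X (m + 1)) :
    single x g = layerHom X m (Pi.mulSingle x g) := rfl

@[simp]
theorem rootLabel_single (x : X m) (g : TreeAut X (m + 1)) : (single x g).rootLabel = 1 :=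
  rootLabel_layerHom _

@[simp]
theorem letterSection_single_self (x : X m) (g : TreeAut X (m + 1)) :
    (single x g).letterSection x = g := by
  classical
  simp [single_apply]

theorem letterSection_single_of_ne {x y : X m} (h : y ≠ x) (g : TreeAut X (m + 1)) :
    (single x g).letterSection y = 1 := by
  classical
  simp [single_apply, h]

theorem rooted_conj_single (σ : Equiv.Perm (X m)) (x : X m) (g : TreeAut X (m + 1)) :
    rooted X m σ * single x g * (rooted X m σ)⁻¹ = single (σ x) g := by
  classical
  rw [single_apply, rooted_conj_layerHom, single_apply]
  congr 1
  funext y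
  by_cases h : y = σ x
  · subst h
    simp
  · have : σ⁻¹ y ≠ x := by
      rintro rfl
      simp at h
    rw [Function.comp_apply, Pi.mulSingle_eq_of_ne this, Pi.mulSingle_eq_of_ne h]

/-- An element of a finite product is the product of its coordinates. -/
theorem layerHom_mem [Finite (X m)] {C : Subgroup (TreeAut X m)}
    {f : X m → TreeAut X (m + 1)} (h : ∀ x, single x (f x) ∈ C) : layerHom X m f ∈ C := by
  classical
  exact Subgroup.pi_mem_of_mulSingle_mem (H := C.comap (layerHom X m)) f fun x => h x

theorem sectionAt_cons (g : TreeAut X m) (x : X m) (v : Vertex X (m + 1)) :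
    g.sectionAt (cons x v) = (g.letterSection x).sectionAt v := rfl

theorem sectionAt_one : ∀ {m : ℕ} (v : Vertex X m), (1 : TreeAut X m).sectionAt v = 1
  | _, root _ => rfl
  | _, cons x v => by
    rw [sectionAt_cons, letterSection_one]
    exact sectionAt_one v

/-- The automorphisms supported on the subtree at the vertex `v`. -/
noncomputable def embed : {m : ℕ} → (v : Vertex X m) → TreeAut X v.endLevel →* TreeAut X m
  | _, root _ => MonoidHom.id _
  | _, cons x v => (single x).comp (embed v)

theorem sectionAt_embed : ∀ {m : ℕ} (v : Vertex X m) (g : TreeAut X v.endLevel),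
    (embed v g).sectionAt v = g
  | _, root _, _ => rfl
  | _, cons x v, g => by
    refine Eq.trans ?_ (sectionAt_embed v g)
    exact congrArg (fun h => sectionAt h v) (letterSection_single_self x (embed v g))

theorem sectionAt_embed_of_ne : ∀ {m : ℕ} (v u : Vertex X m) (g : TreeAut X v.endLevel),
    u.length = v.length → u ≠ v → (embed v g).sectionAt u = 1
  | _, root _, root _, _, _, h => (h rfl).elim
  | _, root _, cons _ _, _, h, _ => by simp [length] at h
  | _, cons _ _, root _, _, h, _ => by simp [length] at h
  | _, cons x v, cons y u, g, h, hne => by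
    change ((single x (embed v g)).letterSection y).sectionAt u = 1
    by_cases hxy : y = x
    · subst hxy
      rw [letterSection_single_self]
      refine sectionAt_embed_of_ne v u g (by simpa [length] using h) ?_
      rintro rfl
      exact hne rfl
    · rw [letterSection_single_of_ne hxy, sectionAt_one]

theorem embed_apply : ∀ {m : ℕ} (v u : Vertex X m) (g : TreeAut X v.endLevel),
    u.length = v.length → (embed v g).1 u = u
  | _, root _, root _, g, _ => apply_root _
  | _, root _, cons _ _, _, h => by simp [length] at h
  | _, cons _ _, root _, _, h => by simp [length] at h
  | _, cons x v, cons y u, g, h => by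
    change (single x (embed v g)).1 (cons y u) = cons y u
    rw [apply_cons_eq, rootLabel_single]
    by_cases hxy : y = x
    · subst hxy
      rw [letterSection_single_self, embed_apply v u g (by simpa [length] using h)]
      rfl
    · rw [letterSection_single_of_ne hxy]
      rfl

end TreeAut

end RootedTree

/-! ### Directed automorphisms and the groups `tame M` -/

namespace RootedTree

open Vertex TreeAut

/-- The data that define directed automorphisms of the tree: a sequence of label groups, a ray
`o`, and homomorphisms from `G` to the label groups, one for each vertex next to the ray. -/
structure SpinalSystem (G : Type u) [Group G] (X : ℕ → Type) where
  /-- the label groups -/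
  labels : ∀ m, Subgroup (Equiv.Perm (X m))
  /-- the letters of the ray -/
  ray : ∀ m, X m
  /-- the action on the letters below the neighbours of the ray -/
  act : ∀ m, X m → G →* Equiv.Perm (X (m + 1))
  act_mem : ∀ m x g, act m x g ∈ labels (m + 1)
  transitive : ∀ m x y, ∃ σ ∈ labels m, σ x = y

namespace SpinalSystem

variable {G : Type u} [Group G] {X : ℕ → Type} (D : SpinalSystem G X)

open Classical in
/-- The action on the tree of the directed automorphism that belongs to `g`. -/
noncomputable def spineFun : {m : ℕ} → G → Vertex X m → Vertex X m
  | m, _, root _ => root m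
  | m, g, cons x v =>
    cons x (if x = D.ray m then spineFun g v else (rooted X (m + 1) (D.act m x g)).1 v)

theorem spineFun_mul : ∀ {m : ℕ} (g h : G) (v : Vertex X m),
    D.spineFun (g * h) v = D.spineFun g (D.spineFun h v)
  | _, _, _, root _ => rfl
  | m, g, h, cons x v => by
    simp only [spineFun]
    split_ifs
    · rw [spineFun_mul g h v]
    · rw [map_mul, map_mul]
      rfl

theorem spineFun_one : ∀ {m : ℕ} (v : Vertex X m), D.spineFun 1 v = v
  | _, root _ => rfl
  | m, cons x v => by
    simp only [spineFun]
    split_ifs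
    · rw [spineFun_one v]
    · rw [map_one, map_one]
      rfl

theorem isChild_spineFun (g : G) {m : ℕ} {v w : Vertex X m} (h : IsChild v w) :
    IsChild (D.spineFun g v) (D.spineFun g w) := by
  induction h with
  | root x =>
    simp only [spineFun]
    split_ifs
    · exact IsChild.root x
    · rw [apply_root]
      exact IsChild.root x
  | cons x h ih =>
    simp only [spineFun]
    split_ifs
    · exact IsChild.cons x ih
    · exact IsChild.cons x (isChild_map _ h)

theorem isChild_spineFun_iff (g : G) {m : ℕ} {v w : Vertex X m} :
    IsChild (D.spineFun g v) (D.spineFun g w) ↔ IsChild v w := by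
  refine ⟨fun h => ?_, D.isChild_spineFun g⟩
  have := D.isChild_spineFun g⁻¹ h
  rwa [← spineFun_mul, ← spineFun_mul, inv_mul_cancel, spineFun_one, spineFun_one] at this

/-- The directed automorphisms: they fix the first layer, the section at the letter `o` of the ray
is again directed, and the sections at the other letters are rooted. -/
noncomputable def spine (m : ℕ) : G →* TreeAut X m where
  toFun g :=
    ⟨{ toFun := D.spineFun g
       invFun := D.spineFun g⁻¹
       left_inv := fun v => by rw [← spineFun_mul, inv_mul_cancel, spineFun_one]
       right_inv := fun v => by rw [← spineFun_mul, mul_inv_cancel, spineFun_one] },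
      rfl, fun v w => by
        simp only [treeGraph, Equiv.coe_fn_mk, isChild_spineFun_iff]⟩
  map_one' := Subtype.ext (Equiv.ext fun v => D.spineFun_one v)
  map_mul' g h := Subtype.ext (Equiv.ext fun v => D.spineFun_mul g h v)

open Classical in
theorem spine_apply_cons (m : ℕ) (g : G) (x : X m) (v : Vertex X (m + 1)) :
    (D.spine m g).1 (cons x v) = cons ((1 : Equiv.Perm (X m)) x)
      ((if x = D.ray m then D.spine (m + 1) g else rooted X (m + 1) (D.act m x g)).1 v) := by
  change D.spineFun g (cons x v) = _
  simp only [spineFun]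
  split_ifs <;> rfl

open Classical in
theorem rootLabel_spine (m : ℕ) (g : G) : (D.spine m g).rootLabel = 1 :=
  (rootLabel_eq_and_letterSection_eq (f := fun x =>
    if x = D.ray m then D.spine (m + 1) g else rooted X (m + 1) (D.act m x g))
    (D.spine_apply_cons m g)).1

open Classical in
theorem letterSection_spine (m : ℕ) (g : G) (x : X m) :
    (D.spine m g).letterSection x =
      if x = D.ray m then D.spine (m + 1) g else rooted X (m + 1) (D.act m x g) :=
  (rootLabel_eq_and_letterSection_eq (D.spine_apply_cons m g)).2 x

theorem letterSection_spine_ray (m : ℕ) (g : G) :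
    (D.spine m g).letterSection (D.ray m) = D.spine (m + 1) g := by
  rw [letterSection_spine, if_pos rfl]

theorem letterSection_spine_of_ne {m : ℕ} (g : G) {x : X m} (h : x ≠ D.ray m) :
    (D.spine m g).letterSection x = rooted X (m + 1) (D.act m x g) := by
  rw [letterSection_spine, if_neg h]

/-- The automorphisms all of whose germs are given by directed automorphisms that belong to
elements of `M`. -/
inductive IsTame (M : Subgroup G) : ∀ {m : ℕ}, TreeAut X m → Prop
  | spine {m : ℕ} {g : G} (hg : g ∈ M) : IsTame M (D.spine m g)
  | step {m : ℕ} {γ : TreeAut X m} (h : γ.rootLabel ∈ D.labels m)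
      (h' : ∀ x, IsTame M (γ.letterSection x)) : IsTame M γ

variable {D} {M : Subgroup G} {m : ℕ}

theorem IsTame.one : D.IsTame M (1 : TreeAut X m) := by
  have := IsTame.spine (D := D) (m := m) M.one_mem
  rwa [map_one] at this

theorem IsTame.rooted {σ : Equiv.Perm (X m)} (hσ : σ ∈ D.labels m) :
    D.IsTame M (rooted X m σ) :=
  .step (by simpa using hσ) fun x => by simpa using IsTame.one

theorem isTame_iff {γ : TreeAut X m} :
    D.IsTame M γ ↔ γ.rootLabel ∈ D.labels m ∧ ∀ x, D.IsTame M (γ.letterSection x) := by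
  refine ⟨fun h => ?_, fun h => .step h.1 h.2⟩
  cases h with
  | step h h' => exact ⟨h, h'⟩
  | @spine _ g hg =>
    rw [rootLabel_spine]
    refine ⟨one_mem _, fun x => ?_⟩
    by_cases hx : x = D.ray m
    · rw [hx, letterSection_spine_ray]
      exact .spine hg
    · rw [letterSection_spine_of_ne _ _ hx]
      exact .rooted (D.act_mem _ _ _)

theorem IsTame.mul_rooted {γ : TreeAut X m} (h : D.IsTame M γ) {σ : Equiv.Perm (X m)}
    (hσ : σ ∈ D.labels m) : D.IsTame M (γ * TreeAut.rooted X m σ) := by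
  rw [isTame_iff] at h ⊢
  simp only [rootLabel_mul, rootLabel_rooted, letterSection_mul, letterSection_rooted, mul_one]
  exact ⟨mul_mem h.1 hσ, fun x => h.2 _⟩

theorem IsTame.mul_spine {γ : TreeAut X m} (h : D.IsTame M γ) {g : G} (hg : g ∈ M) :
    D.IsTame M (γ * D.spine m g) := by
  induction h with
  | spine hg' =>
    rw [← map_mul]
    exact .spine (mul_mem hg' hg)
  | @step m γ h h' ih =>
    refine .step ?_ fun x => ?_
    · rwa [rootLabel_mul, rootLabel_spine, mul_one]
    · rw [letterSection_mul, rootLabel_spine, Equiv.Perm.one_apply]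
      by_cases hx : x = D.ray m
      · rw [hx, letterSection_spine_ray]
        exact ih _
      · rw [letterSection_spine_of_ne _ _ hx]
        exact (h' x).mul_rooted (D.act_mem _ _ _)

theorem IsTame.mul {γ δ : TreeAut X m} (hγ : D.IsTame M γ) (hδ : D.IsTame M δ) :
    D.IsTame M (γ * δ) := by
  induction hδ with
  | spine hg => exact hγ.mul_spine hg
  | step h _ ih =>
    rw [isTame_iff] at hγ
    refine .step ?_ fun x => ?_
    · rw [rootLabel_mul]
      exact mul_mem hγ.1 h
    · rw [letterSection_mul]
      exact ih x (hγ.2 _)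

theorem IsTame.inv {γ : TreeAut X m} (hγ : D.IsTame M γ) : D.IsTame M γ⁻¹ := by
  induction hγ with
  | spine hg =>
    rw [← map_inv]
    exact .spine (inv_mem hg)
  | step h _ ih =>
    refine .step ?_ fun x => ?_
    · rw [rootLabel_inv]
      exact inv_mem h
    · rw [letterSection_inv]
      exact ih _

variable (D M m) in
/-- The group of all automorphisms whose germs are given by elements of `M`. -/
def tame : Subgroup (TreeAut X m) where
  carrier := {γ | D.IsTame M γ}
  one_mem' := .one
  mul_mem' := .mul
  inv_mem' := .inv

theorem mem_tame_iff {γ : TreeAut X m} :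
    γ ∈ D.tame M m ↔
      γ.rootLabel ∈ D.labels m ∧ ∀ x, γ.letterSection x ∈ D.tame M (m + 1) :=
  isTame_iff

theorem spine_mem_tame {g : G} (hg : g ∈ M) : D.spine m g ∈ D.tame M m := .spine hg

theorem rooted_mem_tame {σ : Equiv.Perm (X m)} (hσ : σ ∈ D.labels m) :
    rooted X m σ ∈ D.tame M m := .rooted hσ

theorem single_mem_tame {x : X m} {γ : TreeAut X (m + 1)} (hγ : γ ∈ D.tame M (m + 1)) :
    single x γ ∈ D.tame M m := by
  rw [mem_tame_iff, rootLabel_single]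
  refine ⟨one_mem _, fun y => ?_⟩
  by_cases h : y = x
  · subst h
    rwa [letterSection_single_self]
  · rw [letterSection_single_of_ne h]
    exact one_mem _

theorem tame_mono {M N : Subgroup G} (h : M ≤ N) : D.tame M m ≤ D.tame N m := by
  intro γ hγ
  change D.IsTame M γ at hγ
  change D.IsTame N γ
  induction hγ with
  | spine hg => exact .spine (h hg)
  | step h _ ih => exact .step h ih

theorem single_mem_of_single_mem {C : Subgroup (TreeAut X m)}
    (hC : ∀ σ ∈ D.labels m, rooted X m σ ∈ C) {x : X m} {γ : TreeAut X (m + 1)}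
    (h : single x γ ∈ C) (y : X m) : single y γ ∈ C := by
  obtain ⟨σ, hσ, rfl⟩ := D.transitive m x y
  rw [← rooted_conj_single]
  exact mul_mem (mul_mem (hC σ hσ) h) (inv_mem (hC σ hσ))

/-- Descending along the ray keeps the section `spine g` until the derivation of tameness ends in an
element of `M`. That level is unknown, so faithfulness is needed on all of them. -/
theorem mem_of_spine_mem_tame (hinj : ∀ m, Function.Injective (D.spine m)) {g : G}
    (h : D.spine m g ∈ D.tame M m) : g ∈ M := by
  change D.IsTame M _ at h
  generalize hγ : D.spine m g = γ at h
  induction h with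
  | spine hg =>
    rw [hinj _ hγ]
    exact hg
  | @step m γ _ _ ih =>
    refine ih (D.ray m) ?_
    rw [← hγ, letterSection_spine_ray]

variable [∀ m, Finite (X m)]

/-- If all sections of the directed automorphisms at neighbours of the ray are already in `C`,
then so is the section at the ray. -/
theorem single_spine_mem {C : Subgroup (TreeAut X m)} {g : G}
    (h : ∀ x ≠ D.ray m, single x (rooted X (m + 1) (D.act m x g)) ∈ C)
    (hg : D.spine m g ∈ C) : single (D.ray m) (D.spine (m + 1) g) ∈ C := by
  classical
  set f : X m → TreeAut X (m + 1) := fun x =>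
    if x = D.ray m then 1 else rooted X (m + 1) (D.act m x g) with hf
  have h1 : layerHom X m f ∈ C := by
    refine layerHom_mem fun x => ?_
    by_cases hx : x = D.ray m
    · simp [hf, hx]
    · simpa [hf, hx] using h x hx
  have h2 : single (D.ray m) (D.spine (m + 1) g) = D.spine m g * (layerHom X m f)⁻¹ := by
    rw [eq_mul_inv_iff_mul_eq]
    refine ext_sections ?_ fun x => ?_
    · rw [rootLabel_mul, rootLabel_single, rootLabel_layerHom, rootLabel_spine, mul_one]
    · rw [letterSection_mul, rootLabel_layerHom, letterSection_layerHom, Equiv.Perm.one_apply]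
      by_cases hx : x = D.ray m
      · subst hx
        simp [hf, letterSection_spine_ray]
      · simp [hf, hx, letterSection_spine_of_ne, letterSection_single_of_ne]
  rw [h2]
  exact mul_mem hg (inv_mem h1)

/-- An induction principle: `tame M` is the least family of subgroups, one per level, that contains
the rooted labels and the spines of `M` and is closed under `single`. -/
theorem tame_le {C : ∀ m, Subgroup (TreeAut X m)}
    (h1 : ∀ m, ∀ σ ∈ D.labels m, rooted X m σ ∈ C m)
    (h2 : ∀ m, ∀ g ∈ M, D.spine m g ∈ C m)
    (h3 : ∀ m (x : X m), ∀ γ ∈ C (m + 1), single x γ ∈ C m) (m : ℕ) : D.tame M m ≤ C m := by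
  intro γ hγ
  change D.IsTame M γ at hγ
  induction hγ with
  | spine hg => exact h2 _ _ hg
  | @step m γ h _ ih =>
    rw [← rooted_mul_layerHom γ]
    exact mul_mem (h1 _ _ h) (layerHom_mem fun x => h3 _ _ _ (ih x))

/-- The only point is closure under `single`: dividing `spine g` by its finitary sections off the
ray leaves a copy of `spine g` on the subtree at the ray, and rooted labels carry it to any other
letter. -/
theorem tame_eq_sup : D.tame M m = D.tame ⊥ m ⊔ M.map (D.spine m) := by
  refine le_antisymm ?_ (sup_le (tame_mono bot_le) ?_)
  · refine tame_le (C := fun m => D.tame ⊥ m ⊔ M.map (D.spine m))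
      (fun m σ hσ => Subgroup.mem_sup_left (rooted_mem_tame hσ))
      (fun m g hg => Subgroup.mem_sup_right (Subgroup.mem_map_of_mem _ hg)) (fun m x γ hγ => ?_) m
    revert γ
    change D.tame ⊥ (m + 1) ⊔ M.map (D.spine (m + 1)) ≤
      (D.tame ⊥ m ⊔ M.map (D.spine m)).comap (single x)
    refine sup_le (fun γ hγ => Subgroup.mem_sup_left (single_mem_tame hγ)) ?_
    rintro _ ⟨g, hg, rfl⟩
    refine single_mem_of_single_mem (x := D.ray m) (D := D)
      (fun σ hσ => Subgroup.mem_sup_left (rooted_mem_tame hσ)) (single_spine_mem (fun y _ => ?_) ?_) x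
    · exact Subgroup.mem_sup_left (single_mem_tame (rooted_mem_tame (D.act_mem _ _ _)))
    · exact Subgroup.mem_sup_right (Subgroup.mem_map_of_mem _ hg)
  · rintro _ ⟨g, hg, rfl⟩
    exact spine_mem_tame hg

/-- Every subgroup that properly contains `tame M` contains `tame ⊤`, if `M` is maximal and not
normal. -/
theorem tame_top_le_of_mem (hM : IsCoatom M) (hM' : ¬ M.Normal) {γ : TreeAut X m} (hγ : γ ∈ D.tame ⊤ m)
    (hγ' : γ ∉ D.tame M m) {H : Subgroup (TreeAut X m)} (hH : D.tame M m ≤ H) (hγH : γ ∈ H) :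
    D.tame ⊤ m ≤ H := by
  -- If the extra element is a spine, maximality of `M` in `G` suffices.
  have base : ∀ {m : ℕ} {H : Subgroup (TreeAut X m)} {g : G}, g ∉ M → D.tame M m ≤ H →
      D.spine m g ∈ H → D.tame ⊤ m ≤ H := by
    intro m H g hg hH hgH
    rw [tame_eq_sup]
    refine sup_le ((tame_mono bot_le).trans hH) ?_
    rw [Subgroup.map_le_iff_le_comap]
    have hle : M ≤ H.comap (D.spine m) := fun k hk => hH (spine_mem_tame hk)
    rcases hM.le_iff.1 hle with h | h
    · exact h.ge
    · exact (hg (h ▸ (show g ∈ H.comap (D.spine m) from hgH))).elim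
  obtain ⟨k, hk, g, hg⟩ : ∃ k ∈ M, ∃ g, g * k * g⁻¹ ∉ M := by
    by_contra! h
    exact hM' ⟨h⟩
  have hc : g * k * g⁻¹ * k⁻¹ ∉ M := fun h => hg (by simpa using mul_mem h hk)
  change D.IsTame ⊤ γ at hγ
  induction hγ with
  | @spine m g hg =>
    exact base (fun h => hγ' (spine_mem_tame h)) hH hγH
  | @step m γ h h' ih =>
    obtain ⟨x, hx⟩ : ∃ x, γ.letterSection x ∉ D.tame M (m + 1) := by
      by_contra! hall
      exact hγ' (mem_tame_iff.2 ⟨h, hall⟩)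
    have hmem : layerHom X m γ.letterSection ∈ H := by
      have h1 := hH (rooted_mem_tame (M := M) h)
      have h2 : (rooted X m γ.rootLabel)⁻¹ * γ ∈ H := mul_mem (inv_mem h1) hγH
      rwa [← rooted_mul_layerHom γ, rootLabel_mul, rootLabel_rooted, rootLabel_layerHom, mul_one,
        inv_mul_cancel_left] at h2
    let evx : (X m → TreeAut X (m + 1)) →* TreeAut X (m + 1) :=
      Pi.evalMonoidHom (fun _ => TreeAut X (m + 1)) x
    -- The induction hypothesis is applied to the projection at `x` of the part of `H` given by
    -- `layerHom`, which contains the bad section.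
    have hsec : D.tame ⊤ (m + 1) ≤ (H.comap (layerHom X m)).map evx := by
      refine ih x hx (fun δ hδ => ?_) ⟨_, hmem, rfl⟩
      classical
      refine ⟨Pi.mulSingle x δ, hH (single_mem_tame hδ), ?_⟩
      simp [evx]
    obtain ⟨f, hf, hfx⟩ := hsec (spine_mem_tame (D := D) (Subgroup.mem_top g))
    have hf' : layerHom X m f ∈ H := hf
    have hfx' : f x = D.spine (m + 1) g := hfx
    -- Nothing is known about the coordinates of `f` other than `x`, but the commutator with an
    -- element supported at `x` is trivial there.
    have hcomm : single x (D.spine (m + 1) (g * k * g⁻¹ * k⁻¹)) ∈ H := by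
      classical
      have hk' := hH (single_mem_tame (x := x) (spine_mem_tame (D := D) (m := m + 1) hk))
      have h3 := mul_mem (mul_mem (mul_mem hf' hk') (inv_mem hf')) (inv_mem hk')
      convert h3 using 1
      rw [single_apply, single_apply, ← map_inv, ← map_inv, ← map_mul, ← map_mul, ← map_mul]
      congr 1
      funext y
      by_cases hy : y = x
      · subst hy
        simp [hfx']
      · simp [hy]
    have htop : D.tame ⊤ (m + 1) ≤ H.comap (single x) :=
      base hc (fun δ hδ => hH (single_mem_tame hδ)) hcomm
    intro δ hδ
    rw [mem_tame_iff] at hδ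
    rw [← rooted_mul_layerHom δ]
    refine mul_mem (hH (rooted_mem_tame hδ.1)) (layerHom_mem fun y => ?_)
    exact single_mem_of_single_mem (D := D) (fun σ hσ => hH (rooted_mem_tame hσ))
      (htop (hδ.2 y)) y

end SpinalSystem

end RootedTree

/-! ### Branch structure and the map on subgroups -/

namespace RootedTree

open Vertex TreeAut

namespace SpinalSystem

variable {G : Type u} [Group G] {X : ℕ → Type} {D : SpinalSystem G X} {M : Subgroup G}

theorem sectionAt_mem_tame : ∀ {m : ℕ} (v : Vertex X m) {γ : TreeAut X m},
    γ ∈ D.tame M m → γ.sectionAt v ∈ D.tame M v.endLevel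
  | _, root _, _, h => h
  | _, cons x v, _, h => sectionAt_mem_tame v ((mem_tame_iff.1 h).2 x)

theorem embed_mem_tame : ∀ {m : ℕ} (v : Vertex X m) {γ : TreeAut X v.endLevel},
    γ ∈ D.tame M v.endLevel → embed v γ ∈ D.tame M m
  | _, root _, _, h => h
  | _, cons _ v, _, h => single_mem_tame (embed_mem_tame v h)

theorem embed_mem_rist {v : Vertex X 0} {γ : TreeAut X v.endLevel}
    (h : γ ∈ D.tame M v.endLevel) : embed v γ ∈ rist (D.tame M 0) v :=
  ⟨embed_mem_tame v h, fun u hu => embed_apply v u γ hu,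
    fun u hu hne => sectionAt_embed_of_ne v u γ hu hne⟩

theorem isLayered_tame : IsLayered (D.tame M 0) := by
  intro v
  refine Set.Subset.antisymm (Set.image_mono fun γ h => h.1) ?_
  rintro _ ⟨γ, hγ, rfl⟩
  exact ⟨embed v (γ.sectionAt v), embed_mem_rist (sectionAt_mem_tame v hγ),
    sectionAt_embed v _⟩

theorem exists_mem_tame_apply_eq : ∀ {m : ℕ} (v w : Vertex X m), v.length = w.length →
    ∃ γ ∈ D.tame M m, γ.1 v = w
  | _, root _, root _, _ => ⟨1, one_mem _, rfl⟩
  | _, root _, cons _ _, h => by simp [length] at h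
  | _, cons _ _, root _, h => by simp [length] at h
  | m, cons x v, cons y w, h => by
    obtain ⟨γ, hγ, rfl⟩ := exists_mem_tame_apply_eq v w (by simpa [length] using h)
    obtain ⟨σ, hσ, rfl⟩ := D.transitive m x y
    refine ⟨rooted X m σ * single x γ, mul_mem (rooted_mem_tame hσ) (single_mem_tame hγ), ?_⟩
    rw [apply_cons_eq, rootLabel_mul, rootLabel_single, rootLabel_rooted, letterSection_mul,
      letterSection_rooted, letterSection_single_self, mul_one, one_mul]

theorem tame_subset_autLabels : (D.tame M 0 : Set (TreeAut X 0)) ⊆ autLabels D.labels :=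
  fun _ h v => (mem_tame_iff.1 (sectionAt_mem_tame v h)).1

theorem mem_tame_of_sectionAt_eq_one (n : ℕ) : ∀ {m : ℕ} {γ : TreeAut X m},
    (∀ v : Vertex X m, v.length = n → γ.sectionAt v = 1) →
    (∀ v : Vertex X m, γ.label v ∈ D.labels v.endLevel) → γ ∈ D.tame M m := by
  induction n with
  | zero =>
    intro m γ h _
    have : γ = 1 := h (root m) rfl
    rw [this]
    exact one_mem _
  | succ n ih =>
    intro m γ h h'
    exact mem_tame_iff.2 ⟨h' (root m), fun x =>
      ih (fun v hv => h (cons x v) (by simp [length, hv])) fun v => h' (cons x v)⟩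

theorem finLabels_subset_tame : finLabels D.labels ⊆ D.tame M 0 :=
  fun _ h => mem_tame_of_sectionAt_eq_one h.1.choose h.1.choose_spec h.2

theorem sectionAt_eq_one_of_le : ∀ {m : ℕ} {γ : TreeAut X m} {n k : ℕ}, n ≤ k →
    (∀ v : Vertex X m, v.length = n → γ.sectionAt v = 1) →
    ∀ v : Vertex X m, v.length = k → γ.sectionAt v = 1
  | _, _, n, _, hnk, h, root _, hv => h (root _) (by simp only [length] at hv ⊢; omega)
  | _, γ, 0, _, _, h, cons x v, _ => by
    have : γ = 1 := h (root _) rfl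
    rw [this, sectionAt_one]
  | _, γ, n + 1, k, hnk, h, cons x v, hv => by
    refine sectionAt_eq_one_of_le (γ := γ.letterSection x) (n := n) (k := v.length) ?_
      (fun u hu => h (cons x u) (by simp [length, hu])) v rfl
    simp only [length] at hv
    omega

/-- If `spine g` is trivial, so are its sections along the ray, and hence all the rooted sections
beside the ray. -/
theorem injective_spine (h : ∀ m, ∀ g : G, (∀ k, m ≤ k → ∀ x ≠ D.ray k, D.act k x g = 1) → g = 1)
    (m : ℕ) : Function.Injective (D.spine m) := by
  rw [injective_iff_map_eq_one]
  intro g hg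
  have hspine : ∀ k, D.spine (m + k) g = 1 := by
    intro k
    induction k with
    | zero => exact hg
    | succ k ih =>
      have := D.letterSection_spine_ray (m + k) g
      rw [ih, letterSection_one] at this
      exact this.symm
  refine h m g fun k hk x hx => ?_
  obtain ⟨k, rfl⟩ := Nat.exists_eq_add_of_le hk
  have := D.letterSection_spine_of_ne g hx
  rw [hspine, letterSection_one] at this
  rw [← rootLabel_rooted (D.act _ x g), ← this, rootLabel_one]

variable [∀ m, Finite (X m)]

theorem isFinitary_of_mem_tame_bot {m : ℕ} {γ : TreeAut X m} (h : γ ∈ D.tame ⊥ m) :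
    γ.IsFinitary := by
  change D.IsTame ⊥ γ at h
  induction h with
  | spine hg =>
    rw [Subgroup.mem_bot] at hg
    subst hg
    exact ⟨0, fun v _ => by rw [map_one, sectionAt_one]⟩
  | step _ _ ih =>
    choose n hn using ih
    -- Finitely many letters, so the depths of the sections have a common bound.
    obtain ⟨N, hN⟩ := (Set.finite_range n).bddAbove
    refine ⟨N + 1, fun v hv => ?_⟩
    cases v with
    | root => simp [length] at hv
    | cons x v =>
      exact sectionAt_eq_one_of_le (hN ⟨x, rfl⟩) (hn x) v (by simpa [length] using hv)

theorem finLabels_eq_tame_bot : finLabels D.labels = D.tame ⊥ 0 :=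
  finLabels_subset_tame.antisymm fun _ h =>
    ⟨isFinitary_of_mem_tame_bot h, tame_subset_autLabels h⟩

theorem mem_closure_of_apply_eq (n : ℕ) : ∀ {m : ℕ} {γ : TreeAut X m}, γ ∈ D.tame M m →
    (∀ v : Vertex X m, v.length = n → γ.1 v = v) →
    γ ∈ Subgroup.closure (⋃ v ∈ {v : Vertex X m | v.length = n},
      embed v '' (D.tame M v.endLevel : Set (TreeAut X v.endLevel))) := by
  induction n with
  | zero =>
    intro m γ hγ _
    refine Subgroup.subset_closure ?_
    rw [Set.mem_iUnion₂]
    exact ⟨root m, rfl, γ, hγ, rfl⟩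
  | succ n ih =>
    intro m γ hγ h
    have hsec : ∀ (x : X m) (v : Vertex X (m + 1)), v.length = n →
        γ.rootLabel x = x ∧ (γ.letterSection x).1 v = v := by
      intro x v hv
      have := h (cons x v) (by simp [length, hv])
      rw [apply_cons_eq] at this
      injection this with _ h1 h2
      exact ⟨h1, h2⟩
    -- If layer `n` below a letter were empty, fixing layer `n + 1` would say nothing about the root
    -- label; the ray rules this out.
    have hne : ∀ k, (∀ k, Nonempty (X k)) → ∀ m, ∃ v : Vertex X m, v.length = k := by
      intro k hX
      induction k with
      | zero => exact fun m => ⟨root m, rfl⟩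
      | succ k ih =>
        intro m
        obtain ⟨v, hv⟩ := ih (m + 1)
        obtain ⟨x⟩ := hX m
        exact ⟨cons x v, by simp [length, hv]⟩
    have hlabel : γ.rootLabel = 1 := by
      obtain ⟨v, hv⟩ := hne n (fun k => ⟨D.ray k⟩) (m + 1)
      exact Equiv.ext fun x => (hsec x v hv).1
    rw [← layerHom_letterSection hlabel]
    refine layerHom_mem fun x => ?_
    have hx := ih ((mem_tame_iff.1 hγ).2 x) fun v hv => (hsec x v hv).2
    refine (?_ : Subgroup.map (single x) _ ≤ _) (Subgroup.mem_map_of_mem (single x) hx)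
    rw [MonoidHom.map_closure]
    refine Subgroup.closure_mono ?_
    rintro _ ⟨δ, hδ, rfl⟩
    rw [Set.mem_iUnion₂] at hδ ⊢
    obtain ⟨v, hv, δ, hδ, rfl⟩ := hδ
    exact ⟨cons x v, by simpa [length] using hv, δ, hδ, rfl⟩

theorem mem_ristLayer_of_apply_eq {n : ℕ} {γ : TreeAut X 0} (hγ : γ ∈ D.tame M 0)
    (h : ∀ v : Vertex X 0, v.length = n → γ.1 v = v) : γ ∈ ristLayer (D.tame M 0) n := by
  refine Subgroup.closure_mono ?_ (mem_closure_of_apply_eq n hγ h)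
  refine Set.iUnion₂_mono fun v _ => ?_
  rintro _ ⟨δ, hδ, rfl⟩
  exact embed_mem_rist hδ

/-- The action on the layer of the strings of length `n`. -/
def layerAction (X : ℕ → Type) (n : ℕ) :
    TreeAut X 0 →* Equiv.Perm {v : Vertex X 0 // v.length = n} where
  toFun g := g.1.subtypePerm fun v => by rw [length_apply]
  map_one' := rfl
  map_mul' _ _ := rfl

theorem isBranch_tame : IsBranch (D.tame M 0) := by
  refine ⟨fun v w h => exists_mem_tame_apply_eq v w h, fun n => ?_⟩
  have := finite_length_eq (X := X) n 0
  have hle : ((layerAction X n).comp (D.tame M 0).subtype).ker ≤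
      (ristLayer (D.tame M 0) n).subgroupOf (D.tame M 0) := by
    intro γ hγ
    rw [MonoidHom.mem_ker] at hγ
    refine mem_ristLayer_of_apply_eq γ.2 fun v hv => ?_
    exact congrArg Subtype.val (DFunLike.congr_fun hγ ⟨v, hv⟩)
  exact Subgroup.finiteIndex_of_le hle

/-- The embedding of `G` by directed automorphisms. -/
noncomputable def toTame (D : SpinalSystem G X) : G →* D.tame ⊤ 0 :=
  (D.spine 0).codRestrict _ fun _ => spine_mem_tame (Subgroup.mem_top _)

/-- Transfers `tame_eq_sup` to subgroups of Γ, with `tame ⊥` in the role of Fin. -/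
theorem adjoinFin_eq (M : Subgroup G) :
    adjoinFin D.labels (D.tame ⊤ 0) D.toTame M = (D.tame M 0).subgroupOf (D.tame ⊤ 0) := by
  refine le_antisymm ?_ ?_
  · rw [adjoinFin, Subgroup.closure_le]
    rintro γ (h | ⟨g, hg, rfl⟩)
    · exact finLabels_subset_tame h
    · exact spine_mem_tame hg
  · have h : D.tame M 0 ≤
        (adjoinFin D.labels (D.tame ⊤ 0) D.toTame M).map (D.tame ⊤ 0).subtype := by
      rw [tame_eq_sup]
      refine sup_le (fun γ hγ => ?_) ?_
      · refine ⟨⟨γ, tame_mono bot_le hγ⟩, Subgroup.subset_closure (Or.inl ?_), rfl⟩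
        exact finLabels_eq_tame_bot.ge hγ
      · rintro _ ⟨g, hg, rfl⟩
        exact ⟨D.toTame g, Subgroup.subset_closure (Or.inr ⟨g, hg, rfl⟩), rfl⟩
    intro γ hγ
    obtain ⟨δ, hδ, hδγ⟩ := h hγ
    rwa [← Subtype.ext (show δ.1 = γ.1 from hδγ)]

theorem isCoatom_adjoinFin (hinj : ∀ m, Function.Injective (D.spine m)) (hM : IsCoatom M)
    (hM' : ¬ M.Normal) : IsCoatom (adjoinFin D.labels (D.tame ⊤ 0) D.toTame M) := by
  rw [adjoinFin_eq]
  refine ⟨fun h => hM.1 ?_, fun H hH => ?_⟩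
  · rw [eq_top_iff]
    intro g _
    have : D.toTame g ∈ (D.tame M 0).subgroupOf (D.tame ⊤ 0) := h ▸ Subgroup.mem_top _
    exact mem_of_spine_mem_tame hinj (m := 0) this
  · obtain ⟨hle, γ, hγH, hγ⟩ := SetLike.lt_iff_le_and_exists.1 hH
    have key : D.tame ⊤ 0 ≤ H.map (D.tame ⊤ 0).subtype := by
      refine tame_top_le_of_mem hM hM' γ.2 hγ (fun δ hδ => ?_) ⟨γ, hγH, rfl⟩
      exact ⟨⟨δ, tame_mono le_top hδ⟩, hle hδ, rfl⟩
    rw [eq_top_iff]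
    intro δ _
    obtain ⟨ε, hε, hεδ⟩ := key δ.2
    rwa [← Subtype.ext (show ε.1 = δ.1 from hεδ)]

theorem injective_adjoinFin (hinj : ∀ m, Function.Injective (D.spine m)) :
    Function.Injective (adjoinFin D.labels (D.tame ⊤ 0) D.toTame) := by
  have key : ∀ M (g : G),
      g ∈ M ↔ D.toTame g ∈ adjoinFin D.labels (D.tame ⊤ 0) D.toTame M := by
    intro M g
    rw [adjoinFin_eq]
    exact ⟨fun h => spine_mem_tame h, fun h => mem_of_spine_mem_tame hinj (m := 0) h⟩
  intro M N h
  ext g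
  rw [key, key, h]

end SpinalSystem

end RootedTree

/-! ### Isolating coordinates by commutators in perfect groups -/

section PerfectGroup

/-- A noncentral element of a perfect group has at least three conjugates. -/
theorem Group.IsPerfect.exists_conj_ne {P : Type*} [Group P] [Group.IsPerfect P] {w d : P}
    (hw : w * d ≠ d * w) (u₁ u₂ : P) : ∃ c : P, c * w * c⁻¹ ≠ u₁ ∧ c * w * c⁻¹ ≠ u₂ := by
  by_contra! h
  have hne : d * w * d⁻¹ ≠ w := fun hd => hw (mul_inv_eq_iff_eq_mul.1 hd).symm
  have hor : ∀ c, c * w * c⁻¹ = w ∨ c * w * c⁻¹ = d * w * d⁻¹ := by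
    intro c
    have h1 := h 1
    have hd := h d
    have hc := h c
    simp only [one_mul, inv_one, mul_one] at h1
    clear h hw
    generalize c * w * c⁻¹ = y at *
    generalize d * w * d⁻¹ = z at *
    by_cases h₁ : w = u₁ <;> by_cases h₂ : z = u₁ <;> by_cases h₃ : y = u₁ <;> simp_all
  have hcent : ∀ c : P, c ∈ Subgroup.centralizer {w} ↔ c * w * c⁻¹ = w := by
    intro c
    rw [Subgroup.mem_centralizer_singleton_iff, mul_inv_eq_iff_eq_mul]
  have key : ∀ c e : P, c ∉ Subgroup.centralizer {w} → e ∉ Subgroup.centralizer {w} →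
      c⁻¹ * e ∈ Subgroup.centralizer {w} := by
    intro c e hc he
    rw [hcent] at hc he ⊢
    have h1 := (hor c).resolve_left hc
    have h2 := (hor e).resolve_left he
    calc c⁻¹ * e * w * (c⁻¹ * e)⁻¹ = c⁻¹ * (e * w * e⁻¹) * c := by group
      _ = c⁻¹ * (c * w * c⁻¹) * c := by rw [h2, ← h1]
      _ = w := by group
  -- With exactly two conjugates the centraliser has index 2, so membership in it behaves like a
  -- sign and every commutator is even.
  have hmul : ∀ c e : P, c * e ∈ Subgroup.centralizer {w} ↔
      (c ∈ Subgroup.centralizer {w} ↔ e ∈ Subgroup.centralizer {w}) := by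
    intro c e
    by_cases hc : c ∈ Subgroup.centralizer {w}
    · simp [hc, Subgroup.mul_mem_cancel_left]
    · by_cases he : e ∈ Subgroup.centralizer {w}
      · simp [hc, he, Subgroup.mul_mem_cancel_right]
      · have := key c⁻¹ e (by rwa [inv_mem_iff]) he
        rw [inv_inv] at this
        simp [hc, he, this]
  have htop : commutator P ≤ Subgroup.centralizer {w} := by
    rw [commutator_def, Subgroup.commutator_le]
    intro c _ e _
    rw [commutatorElement_def, hmul, hmul, hmul, inv_mem_iff, inv_mem_iff]
    tauto
  rw [Group.IsPerfect.commutator_eq_top] at htop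
  exact hne ((hcent d).1 (htop (Subgroup.mem_top d)))

variable {X A P : Type*} [Group A] [Group P] [Group.IsPerfect P] {N : Subgroup (X → A)}
  {θ : P →* A} {x y : X}

/-- The commutator of a function trivial off `T` with one trivial at `y` is trivial off `T \ {y}`.
The values realised this way form a subgroup that contains all commutators, hence all of `P`. -/
theorem Subgroup.exists_mem_apply_eq_one {T : Set X}
    (h1 : ∀ p, ∃ f ∈ N, f x = θ p ∧ ∀ z ∉ T, f z = 1)
    (h2 : ∀ p, ∃ f ∈ N, f x = θ p ∧ f y = 1) (p : P) :
    ∃ f ∈ N, f x = θ p ∧ ∀ z ∉ T \ {y}, f z = 1 := by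
  let B : Subgroup P :=
    { carrier := {p | ∃ f ∈ N, f x = θ p ∧ ∀ z ∉ T \ {y}, f z = 1}
      one_mem' := ⟨1, one_mem _, by simp, fun _ _ => rfl⟩
      mul_mem' := by
        rintro p q ⟨f, hf, hfx, hfT⟩ ⟨g, hg, hgx, hgT⟩
        exact ⟨f * g, mul_mem hf hg, by simp [hfx, hgx], fun z hz => by simp [hfT z hz, hgT z hz]⟩
      inv_mem' := by
        rintro p ⟨f, hf, hfx, hfT⟩
        exact ⟨f⁻¹, inv_mem hf, by simp [hfx], fun z hz => by simp [hfT z hz]⟩ }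
  have hB : _root_.commutator P ≤ B := by
    rw [_root_.commutator_def, Subgroup.commutator_le]
    intro p _ q _
    obtain ⟨f, hf, hfx, hfT⟩ := h1 p
    obtain ⟨g, hg, hgx, hgy⟩ := h2 q
    refine ⟨f * g * f⁻¹ * g⁻¹, mul_mem (mul_mem (mul_mem hf hg) (inv_mem hf)) (inv_mem hg), ?_, ?_⟩
    · simp [commutatorElement_def, hfx, hgx]
    · intro z hz
      by_cases hzy : z = y
      · subst hzy
        simp [hgy]
      · have : z ∉ T := fun h => hz ⟨h, hzy⟩
        simp [hfT z this]
  rw [Group.IsPerfect.commutator_eq_top] at hB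
  exact hB (Subgroup.mem_top p)

/-- If functions in `N` with three-point support realise a perfect group at `x`, and `N` is
invariant under permutations that fix `x` and move the other two points away, then `N` contains
the functions supported at `x` with values in this group. -/
theorem Subgroup.mulSingle_mem_of_isPerfect [DecidableEq X] {y₁ y₂ : X}
    (h : ∀ p, ∃ f ∈ N, f x = θ p ∧ ∀ z ∉ ({x, y₁, y₂} : Set X), f z = 1)
    (h₁ : ∃ τ : X → X, (∀ f ∈ N, f ∘ τ ∈ N) ∧ τ x = x ∧ τ y₁ ∉ ({x, y₁, y₂} : Set X))
    (h₂ : ∃ τ : X → X, (∀ f ∈ N, f ∘ τ ∈ N) ∧ τ x = x ∧ τ y₂ ∉ ({x, y₁, y₂} : Set X)) (p : P) :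
    Pi.mulSingle x (θ p) ∈ N := by
  -- Precomposing with `τ` replaces the value at `y` by one outside the support.
  have key : ∀ y, (∃ τ : X → X, (∀ f ∈ N, f ∘ τ ∈ N) ∧ τ x = x ∧
      τ y ∉ ({x, y₁, y₂} : Set X)) → ∀ p, ∃ f ∈ N, f x = θ p ∧ f y = 1 := by
    rintro y ⟨τ, hτ, hx, hy⟩ p
    obtain ⟨f, hf, hfx, hfT⟩ := h p
    exact ⟨f ∘ τ, hτ f hf, by simp [hx, hfx], hfT _ hy⟩
  obtain ⟨f, hf, hfx, hfT⟩ :=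
    exists_mem_apply_eq_one (exists_mem_apply_eq_one h (key y₁ h₁)) (key y₂ h₂) p
  convert hf
  funext z
  by_cases hz : z = x
  · subst hz
    simp [hfx]
  · rw [Pi.mulSingle_eq_of_ne hz, hfT z]
    simp [hz]
    tauto

end PerfectGroup

/-! ### The translation system and finite generation -/

namespace RootedTree

open TreeAut

/-- The action of `P × P` on `P` by left and right translations. -/
def translate (P : Type*) [Group P] : P × P →* Equiv.Perm P where
  toFun p :=
    { toFun := fun x => p.1 * x * p.2⁻¹
      invFun := fun x => p.1⁻¹ * x * p.2
      left_inv := fun x => by group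
      right_inv := fun x => by group }
  map_one' := Equiv.ext fun x => by simp
  map_mul' p q := Equiv.ext fun x => by simp [mul_assoc]

theorem translate_apply {P : Type*} [Group P] (p q x : P) :
    translate P (p, q) x = p * x * q⁻¹ := rfl

section

variable {G : Type u} [Group G] {P : ℕ → Type} [∀ m, Group (P m)] (π : ∀ m, G →* P m)
  (a b : ∀ m, P m)

open Classical in
/-- The spinal system in which `P m × P m` acts on `P m` by translations, and `G` acts by left
translations below the neighbour `1` and by right translations below the neighbour `b` of the
ray `a`. -/
noncomputable def translationSystem : SpinalSystem G P where
  labels m := (translate (P m)).range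
  ray := a
  act m x :=
    if x = 1 then (translate (P (m + 1))).comp ((MonoidHom.inl _ _).comp (π (m + 1)))
    else if x = b m then (translate (P (m + 1))).comp ((MonoidHom.inr _ _).comp (π (m + 1)))
    else 1
  act_mem m x g := by
    split_ifs
    · exact ⟨_, rfl⟩
    · exact ⟨_, rfl⟩
    · exact one_mem _
  transitive m x y := ⟨_, ⟨(y * x⁻¹, 1), rfl⟩, by simp [translate_apply]⟩

variable {π a b}

theorem act_translationSystem_one (m : ℕ) (g : G) : (translationSystem π a b).act m 1 g =
    translate (P (m + 1)) (π (m + 1) g, 1) := by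
  simp [translationSystem]

theorem act_translationSystem_right {m : ℕ} (h : b m ≠ 1) (g : G) :
    (translationSystem π a b).act m (b m) g = translate (P (m + 1)) (1, π (m + 1) g) := by
  simp [translationSystem, h]

theorem act_translationSystem_of_ne {m : ℕ} {x : P m} (h : x ≠ 1) (h' : x ≠ b m) (g : G) :
    (translationSystem π a b).act m x g = 1 := by
  simp [translationSystem, h, h']

theorem injective_spine_translationSystem (hab : ∀ m, a m * b m ≠ b m * a m)
    (hπ : ∀ m g, (∀ k, m ≤ k → π (k + 1) g = 1) → g = 1) (m : ℕ) :
    Function.Injective ((translationSystem π a b).spine m) := by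
  refine SpinalSystem.injective_spine (fun m g hg => hπ m g fun k hk => ?_) m
  have h1 : (1 : P k) ≠ a k := by
    intro h
    exact hab k (by simp [← h])
  have h2 := hg k hk 1 h1
  rw [act_translationSystem_one] at h2
  simpa [translate_apply] using Equiv.congr_fun h2 1

/-- The stabiliser of `x` consists of the pairs `(x c x⁻¹, c)` and conjugates `x⁻¹ y` by `c`. A
noncentral element has a third conjugate, and its conjugates are never 1. -/
theorem exists_translate_apply_notMem {P : Type*} [Group P] [Group.IsPerfect P] {x y d y₁ y₂ : P}
    (h : x⁻¹ * y * d ≠ d * (x⁻¹ * y)) : ∃ τ ∈ (translate P).range, τ x = x ∧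
      τ y ∉ ({x, y₁, y₂} : Set P) := by
  obtain ⟨c, hc₁, hc₂⟩ := Group.IsPerfect.exists_conj_ne h (x⁻¹ * y₁) (x⁻¹ * y₂)
  have hy : translate P (x * c * x⁻¹, c) y = x * (c * (x⁻¹ * y) * c⁻¹) := by
    rw [translate_apply]
    group
  refine ⟨_, ⟨(x * c * x⁻¹, c), rfl⟩, by simp [translate_apply], ?_⟩
  rw [hy]
  rintro (h0 | h1 | h2)
  · have hxy : x⁻¹ * y = 1 := by simpa using h0
    simp [hxy] at h
  · exact hc₁ (eq_inv_mul_iff_mul_eq.2 h1)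
  · exact hc₂ (eq_inv_mul_iff_mul_eq.2 h2)

variable [∀ m, Finite (P m)] [∀ m, Group.IsPerfect (P m)]

theorem tame_translationSystem_le (hab : ∀ m, a m * b m ≠ b m * a m)
    (hπ : ∀ m, Function.Surjective (π m)) (m : ℕ) :
    (translationSystem π a b).tame ⊤ m ≤
      ((rooted P m).comp (translate (P m))).range ⊔ ((translationSystem π a b).spine m).range := by
  set D := translationSystem π a b with hD
  set K : ∀ m, Subgroup (TreeAut P m) := fun m =>
    ((rooted P m).comp (translate (P m))).range ⊔ (D.spine m).range with hK
  have hroot : ∀ m, ∀ σ ∈ D.labels m, rooted P m σ ∈ K m := by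
    rintro m _ ⟨p, rfl⟩
    exact Subgroup.mem_sup_left ⟨p, rfl⟩
  have hspine : ∀ m g, D.spine m g ∈ K m := fun m g => Subgroup.mem_sup_right ⟨g, rfl⟩
  have ha1 : ∀ m, a m ≠ 1 := fun m h => hab m (by simp [h])
  have hb1 : ∀ m, b m ≠ 1 := fun m h => hab m (by simp [h])
  have hba : ∀ m, b m ≠ a m := fun m h => hab m (by rw [h])
  -- Handles the left and the right neighbour at once; `x` is the one to isolate, `y₁` and `y₂` the
  -- remaining letters among `1`, `a m`, `b m`. All differences of these three are noncentral
  -- because `a m` and `b m` do not commute.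
  have hsingle : ∀ m (x y₁ y₂ : P m) (θ : P (m + 1) →* TreeAut P (m + 1)),
      ({x, y₁, y₂} : Set (P m)) = {1, a m, b m} →
      (∀ g, (D.spine m g).letterSection x = θ (π (m + 1) g)) →
      (∃ d, x⁻¹ * y₁ * d ≠ d * (x⁻¹ * y₁)) → (∃ d, x⁻¹ * y₂ * d ≠ d * (x⁻¹ * y₂)) →
      ∀ p, single x (θ p) ∈ K m := by
    rintro m x y₁ y₂ θ hset hθ ⟨d₁, hd₁⟩ ⟨d₂, hd₂⟩ p
    classical
    have hcomp : ∀ τ ∈ D.labels m, ∀ f ∈ (K m).comap (layerHom P m),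
        f ∘ τ ∈ (K m).comap (layerHom P m) := by
      intro τ hτ f hf
      have h1 := hroot m _ (inv_mem hτ)
      have h2 := mul_mem (mul_mem h1 hf) (inv_mem h1)
      rwa [rooted_conj_layerHom, inv_inv] at h2
    refine Subgroup.mulSingle_mem_of_isPerfect (N := (K m).comap (layerHom P m)) (θ := θ)
      (x := x) (y₁ := y₁) (y₂ := y₂) ?_ ?_ ?_ p
    · intro p
      obtain ⟨g, rfl⟩ := hπ (m + 1) p
      refine ⟨(D.spine m g).letterSection, ?_, hθ g, fun z hz => ?_⟩
      · rw [Subgroup.mem_comap, layerHom_letterSection (D.rootLabel_spine m g)]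
        exact hspine m g
      · rw [hset] at hz
        simp only [Set.mem_insert_iff, Set.mem_singleton_iff, not_or] at hz
        rw [D.letterSection_spine_of_ne g hz.2.1, hD, act_translationSystem_of_ne hz.1 hz.2.2,
          map_one]
    · obtain ⟨τ, hτ, hx, hy⟩ := exists_translate_apply_notMem (y₁ := y₁) (y₂ := y₂) hd₁
      exact ⟨τ, hcomp τ hτ, hx, hy⟩
    · obtain ⟨τ, hτ, hx, hy⟩ := exists_translate_apply_notMem (y₁ := y₁) (y₂ := y₂) hd₂
      exact ⟨τ, hcomp τ hτ, hx, hy⟩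
  have hleft : ∀ m (p : P (m + 1)) (x : P m),
      single x (rooted P (m + 1) (translate _ (p, 1))) ∈ K m := by
    intro m p x
    refine SpinalSystem.single_mem_of_single_mem (D := D) (hroot m) (x := 1) ?_ x
    refine hsingle m 1 (a m) (b m)
      (((rooted P (m + 1)).comp (translate _)).comp (MonoidHom.inl _ _)) rfl (fun g => ?_)
      ⟨b m, ?_⟩ ⟨a m, ?_⟩ p
    · rw [D.letterSection_spine_of_ne g (ha1 m).symm, hD, act_translationSystem_one]
      rfl
    · simpa using hab m
    · simpa using (hab m).symm
  have hright : ∀ m (p : P (m + 1)) (x : P m),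
      single x (rooted P (m + 1) (translate _ (1, p))) ∈ K m := by
    intro m p x
    refine SpinalSystem.single_mem_of_single_mem (D := D) (hroot m) (x := b m) ?_ x
    refine hsingle m (b m) 1 (a m)
      (((rooted P (m + 1)).comp (translate _)).comp (MonoidHom.inr _ _)) ?_ (fun g => ?_)
      ⟨a m, ?_⟩ ⟨b m, ?_⟩ p
    · ext z
      simp only [Set.mem_insert_iff, Set.mem_singleton_iff]
      tauto
    · rw [D.letterSection_spine_of_ne g (hba m), hD, act_translationSystem_right (hb1 m)]
      rfl
    · intro h
      apply hab m
      rw [mul_one, inv_mul_eq_iff_eq_mul, ← mul_assoc, eq_mul_inv_iff_mul_eq] at h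
      exact h
    · intro h
      apply hab m
      rw [mul_assoc, inv_mul_eq_iff_eq_mul, mul_inv_cancel_left] at h
      exact h
  -- A translation by `(p, q)` splits into a left one from the neighbour `1` and a right one from `b
  -- m`.
  have hlabels : ∀ m (x : P m), ∀ σ ∈ D.labels (m + 1),
      single x (rooted P (m + 1) σ) ∈ K m := by
    rintro m x _ ⟨⟨p, q⟩, rfl⟩
    have : ((p, q) : P (m + 1) × P (m + 1)) = (p, 1) * (1, q) := by simp
    rw [this, map_mul, map_mul, map_mul]
    exact mul_mem (hleft m p x) (hright m q x)
  refine SpinalSystem.tame_le (C := K) hroot (fun m g _ => hspine m g) (fun m x γ hγ => ?_) m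
  revert γ
  change K (m + 1) ≤ (K m).comap (single x)
  refine sup_le ?_ ?_
  · rintro _ ⟨p, rfl⟩
    exact hlabels m x _ ⟨p, rfl⟩
  · rintro _ ⟨g, rfl⟩
    exact SpinalSystem.single_mem_of_single_mem (D := D) (hroot m)
      (SpinalSystem.single_spine_mem (fun y _ => hlabels m y _ (D.act_mem m y g)) (hspine m g)) x

theorem fg_tame_translationSystem (hab : ∀ m, a m * b m ≠ b m * a m)
    (hπ : ∀ m, Function.Surjective (π m)) [Group.FG G] :
    Group.FG ((translationSystem π a b).tame ⊤ 0) := by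
  rw [Group.fg_iff_subgroup_fg]
  have h : (translationSystem π a b).tame ⊤ 0 =
      ((rooted P 0).comp (translate (P 0))).range ⊔
        ((translationSystem π a b).spine 0).range := by
    refine le_antisymm (tame_translationSystem_le hab hπ 0) (sup_le ?_ ?_)
    · rintro _ ⟨p, rfl⟩
      exact SpinalSystem.rooted_mem_tame ⟨p, rfl⟩
    · rintro _ ⟨g, rfl⟩
      exact SpinalSystem.spine_mem_tame (Subgroup.mem_top g)
  rw [h]
  refine Subgroup.FG.sup ?_ ?_ <;> rw [← Group.fg_iff_subgroup_fg] <;> infer_instance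

end

end RootedTree

/-! ### Choice of the quotients and conclusion -/

open RootedTree

theorem exists_branchGroup_of_sequence {G : Type u} [Group G] {P : ℕ → Type}
    [∀ m, Group (P m)] [∀ m, Finite (P m)] [∀ m, Nontrivial (P m)] [∀ m, Group.IsPerfect (P m)]
    (π : ∀ m, G →* P m) (hπ : ∀ m, Function.Surjective (π m))
    (hπ' : ∀ m g, (∀ k, m ≤ k → π (k + 1) g = 1) → g = 1) :
    ∃ (X : ℕ → Type) (Γ : Subgroup (TreeAut X 0))
      (S : ∀ n, Subgroup (Equiv.Perm (X n))) (ι : G →* Γ),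
      (∀ n, Finite (X n) ∧ Nontrivial (X n)) ∧
      IsBranch Γ ∧ IsLayered Γ ∧
      Function.Injective ι ∧
      finLabels S ⊆ Γ ∧ (Γ : Set (TreeAut X 0)) ⊆ autLabels S ∧
      (∀ M ∈ nonNormalMaximal G, IsCoatom (adjoinFin S Γ ι M)) ∧
      Set.InjOn (adjoinFin S Γ ι) (nonNormalMaximal G) ∧
      (Group.FG G → Group.FG Γ) := by
  have hex : ∀ m, ∃ a b : P m, a * b ≠ b * a := by
    intro m
    by_contra! h
    have hc : commutator (P m) ≤ ⊥ := by
      rw [commutator_def, Subgroup.commutator_le]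
      intro c _ d _
      rw [Subgroup.mem_bot, commutatorElement_eq_one_iff_mul_comm]
      exact h c d
    rw [Group.IsPerfect.commutator_eq_top] at hc
    exact top_ne_bot (le_bot_iff.1 hc)
  choose a b hab using hex
  have hinj := injective_spine_translationSystem hab hπ'
  refine ⟨P, (translationSystem π a b).tame ⊤ 0, (translationSystem π a b).labels,
    (translationSystem π a b).toTame, fun n => ⟨inferInstance, inferInstance⟩,
    SpinalSystem.isBranch_tame, SpinalSystem.isLayered_tame, fun g h hgh => ?_,
    SpinalSystem.finLabels_subset_tame, SpinalSystem.tame_subset_autLabels,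
    fun M hM => SpinalSystem.isCoatom_adjoinFin hinj hM.1 hM.2,
    (SpinalSystem.injective_adjoinFin hinj).injOn,
    fun _ => fg_tame_translationSystem hab hπ⟩
  exact hinj 0 (congrArg Subtype.val hgh)

theorem isPerfect_alternatingGroup_five : Group.IsPerfect (alternatingGroup (Fin 5)) := by
  rw [Group.isPerfect_def]
  exact commutator_alternatingGroup_eq_top (by simp)

theorem theorem1p1 (G : Type u) [Group G] (hG : IsCountablyBasedResiduallyFinitePerfect G) :
    ∃ (X : ℕ → Type) (Γ : Subgroup (RootedTree.TreeAut X 0))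
      (S : ∀ n, Subgroup (Equiv.Perm (X n))) (ι : G →* Γ),
      (∀ n, Finite (X n) ∧ Nontrivial (X n)) ∧
      RootedTree.IsBranch Γ ∧ RootedTree.IsLayered Γ ∧
      Function.Injective ι ∧
      RootedTree.finLabels S ⊆ Γ ∧ (Γ : Set (RootedTree.TreeAut X 0)) ⊆ RootedTree.autLabels S ∧
      (∀ M ∈ nonNormalMaximal G, IsCoatom (RootedTree.adjoinFin S Γ ι M)) ∧
      Set.InjOn (RootedTree.adjoinFin S Γ ι) (nonNormalMaximal G) ∧
      (Group.FG G → Group.FG Γ) := by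
  rcases subsingleton_or_nontrivial G with hsub | hnon
  -- The trivial group may have no nontrivial factor to build a tree from. It has no maximal
  -- subgroups, so any finitely generated example will do.
  · have := isPerfect_alternatingGroup_five
    obtain ⟨X, Γ, S, ι, hX, hbranch, hlayered, -, hfin, haut, -, -, hfg⟩ :=
      exists_branchGroup_of_sequence (P := fun _ => alternatingGroup (Fin 5))
        (fun _ => MonoidHom.id (alternatingGroup (Fin 5))) (fun _ => Function.surjective_id)
        (fun m g h => h m le_rfl)
    have hmax : ∀ M : Subgroup G, M ∉ nonNormalMaximal G := fun M hM =>
      hM.1.1 (Subsingleton.elim _ _)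
    exact ⟨X, Γ, S, 1, hX, hbranch, hlayered, Function.injective_of_subsingleton _, hfin, haut,
      fun M hM => (hmax M hM).elim, fun M hM => (hmax M hM).elim, fun _ => hfg inferInstance⟩
  · obtain ⟨I, P, _, φ, hI, hfin, hperf, hinj, hsurj⟩ := hG
    -- Trivial factors cannot serve as alphabets and separate nothing.
    let J := {i // Nontrivial (P i)}
    have hsep : ∀ g, (∀ j : J, φ g j.1 = 1) → g = 1 := by
      intro g hg
      refine (injective_iff_map_eq_one φ).1 hinj g (funext fun i => ?_)
      rcases subsingleton_or_nontrivial (P i) with h | h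
      · exact Subsingleton.elim _ _
      · exact hg ⟨i, h⟩
    have hJ : Nonempty J := by
      by_contra h
      rw [not_nonempty_iff] at h
      obtain ⟨g, hg⟩ := exists_ne (1 : G)
      exact hg (hsep g fun j => h.elim j)
    obtain ⟨e, he⟩ := exists_surjective_nat J
    have (m : ℕ) : Nontrivial (P (e m.unpair.1).1) := (e m.unpair.1).2
    -- Unpairing makes every factor recur beyond any level.
    refine exists_branchGroup_of_sequence (P := fun m => P (e m.unpair.1).1)
      (fun m => (Pi.evalMonoidHom P (e m.unpair.1).1).comp φ) (fun m => hsurj _)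
      (fun m g h => hsep g fun j => ?_)
    obtain ⟨n, rfl⟩ := he j
    have key : ∀ k : ℕ, k.unpair.1 = n → φ g (e k.unpair.1).1 = 1 → φ g (e n).1 = 1 := by
      rintro k rfl hk
      exact hk
    have hle := Nat.right_le_pair n (m + 1)
    -- The index `Nat.pair n (m + 1)` is at least `m + 1` and has factor `e n`; the 1 is subtracted
    -- because level `k` acts through `P (k + 1)`.
    have hk := h (Nat.pair n (m + 1) - 1) (by omega)
    rw [Nat.sub_add_cancel (by omega)] at hk
    exact key _ (by simp) hk
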